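/- **Theorem.** Let $1\le p<\infty$, $C_D,C_P,a>0$ and $\lambda\ge 1$. There is a constant $A>0$, depending only on $p$, $C_D$, $C_P$, $\lambda$ and $a$, such that the following holds. Let $(X,d)$ be a metric space and let $\mu$ be a complete Borel measure on $X$ (the completion of a measure on the Borel sets) with $0<\mu(B)<\infty$ for all balls $B(x,\rho)=\{y: d(x,y)<\rho\}$, $\rho>0$. Assume that * $\mu$ is globally doubling: $\mu(B(x,2\rho))\le C_D\,\mu(B(x,\rho))$ for all $x\in X$, $\rho>0$; * $X$ supports a global $p$-Poincaré inequality: for all $x\in X$, $\rho>0$, all integrable $f:X\to[-\infty,\infty]$ and all upper gradients $g$ of $f$, with $B=B(x,\rho)$, $\lambda B=B(x,\lambda\rho)$, $f_B=\frac1{\mu(B)}\int_B f\,d\mu$, $$\frac1{\mu(B)}\int_B|f-f_B|\,d\mu\le C_P\,\rho\left(\frac1{\mu(\lambda B)}\int_{\lambda B}g^p\,d\mu\right)^{1/p}.$$ Let $x_0\in X$, $B_\rho=B(x_0,\rho)$, let $0<\tfrac12R\le r<R$ and $\delta=R-r$, and assume that for every $x\in B_R\setminus B_r$ there are $x',x''\in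 X$ with $B(x',a\delta)\subset B(x,2\delta)\cap B_r$ and $B(x'',a\delta)\subset B(x,2\delta)\setminus B_R$. Then $$\frac1A\,\frac{\mu(B_R\setminus B_r)}{(R-r)^p}\le \operatorname{cap}_p(B_r,B_R)\le A\,\frac{\mu(B_R\setminus B_r)}{(R-r)^p}.$$ Here curves are nonconstant, compact, rectifiable and parametrized by arc length. A Borel function $g:X\to[0,\infty]$ is an upper gradient of $f:X\to[-\infty,\infty]$ if $|f(\gamma(0))-f(\gamma(\ell_\gamma))|\le\int_\gamma g\,ds$ for every curve $\gamma:[0,\ell_\gamma]\to X$ (the left-hand side being $\infty$ if one of the terms is infinite); a $\mu$-measurable $g$ is a $p$-weak upper gradient if this holds for all curves outside a family $\Gamma$ for which some $0\le\rho\in L^p(X)$ satisfies $\int_\gamma\rho\,ds=\infty$ for all $\gamma\in\Gamma$. The minimal $p$-weak upper gradient $g_u$ of $u$ is the (a.e. unique) $p$-weak upper gradient in $L^p(X)$ that is a.e. at most every other $p$-weak upper gradient of $u$ in $L^p(X)$. The Newtonian space $N^{1,p}(X)$ consists of the measurable functions $u:X\to[-\infty,\infty]$ with $\int_X|u|^p\,d\mu+\inf_g\int_X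 g^p\,d\mu<\infty$, the infimum being over all upper gradients $g$ of $u$. For $\Omega$ open and $E\subset\Omega$, $\operatorname{cap}_p(E,\Omega)=\inf_u\int_\Omega g_u^p\,d\mu$, the infimum being over all $u\in N^{1,p}(X)$ with $\chi_E\le u\le1$ in $\Omega$ and $u=0$ on $X\setminus\Omega$. -/

import Mathlib

open MeasureTheory Set Metric
open scoped ENNReal NNReal

namespace MetricSobolev

universe u

/-- A nonconstant compact rectifiable curve, given by its arc length parametrization
`[0, ℓ] → X`, `0 < ℓ`. Only the values of `toFun` on `[0, ℓ]` matter. Unit speed on `[0, ℓ]` means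
that the length of the restriction to `[s, t]` is `t - s` for all `0 ≤ s ≤ t ≤ ℓ`; in particular
the curve is continuous (1-Lipschitz) there. -/
structure ArcCurve (X : Type u) [MetricSpace X] where
  length : ℝ
  toFun : ℝ → X
  length_pos : 0 < length
  unitSpeed : HasUnitSpeedOn toFun (Icc 0 length)

variable {X : Type u} [MetricSpace X]

/-- The line integral `∫_γ g ds`. -/
noncomputable def ArcCurve.lineIntegral (γ : ArcCurve X) (g : X → ℝ≥0∞) : ℝ≥0∞ :=
  ∫⁻ t in Icc 0 γ.length, g (γ.toFun t)

/-- The inequality `|f(γ(0)) - f(γ(ℓ))| ≤ ∫_γ g ds`. Since `(⊤ : EReal) - ⊤ = ⊥`,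
`⊥ - ⊥ = ⊥` and `EReal.abs ⊤ = EReal.abs ⊥ = ⊤`, the left-hand side is `⊤` as soon as one of the
two values of `f` is infinite. -/
def ArcCurve.GradientBound (γ : ArcCurve X) (f : X → EReal) (g : X → ℝ≥0∞) : Prop :=
  (f (γ.toFun 0) - f (γ.toFun γ.length)).abs ≤ γ.lineIntegral g

variable [MeasurableSpace X]

/-- A curve family has zero `p`-modulus: some nonnegative `ρ ∈ L^p` has infinite line integral
along each of its curves. -/
def ZeroModulus (p : ℝ) (μ : Measure X) (Γ : Set (ArcCurve X)) : Prop :=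
  ∃ ρ : X → ℝ≥0∞, Measurable ρ ∧ ∫⁻ x, ρ x ^ p ∂μ < ⊤ ∧ ∀ γ ∈ Γ, γ.lineIntegral ρ = ⊤

/-- `g` is an upper gradient of `f` (`Measurable` means Borel on a `BorelSpace`). -/
def IsUpperGradient (f : X → EReal) (g : X → ℝ≥0∞) : Prop :=
  Measurable g ∧ ∀ γ : ArcCurve X, γ.GradientBound f g

/-- `g` is a `p`-weak upper gradient of `f`. Measurability is with respect to the completion of
`μ`, which is `AEMeasurable` for the Borel measure `μ`. -/
def IsWeakUpperGradient (p : ℝ) (μ : Measure X) (f : X → EReal) (g : X → ℝ≥0∞) : Prop :=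
  AEMeasurable g μ ∧ ZeroModulus p μ {γ : ArcCurve X | ¬ γ.GradientBound f g}

/-- `g` is a minimal `p`-weak upper gradient of `f`: it is a `p`-weak upper gradient in `L^p`
and lies a.e. below each `p`-weak upper gradient of `f` in `L^p`. -/
def IsMinimalWeakUpperGradient (p : ℝ) (μ : Measure X) (f : X → EReal) (g : X → ℝ≥0∞) : Prop :=
  IsWeakUpperGradient p μ f g ∧ ∫⁻ x, g x ^ p ∂μ < ⊤ ∧
    ∀ g' : X → ℝ≥0∞, IsWeakUpperGradient p μ f g' → ∫⁻ x, g' x ^ p ∂μ < ⊤ → g ≤ᵐ[μ] g'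

/-- The Newtonian (semi)norm, with the infimum over all upper gradients. -/
noncomputable def newtonianNorm (p : ℝ) (μ : Measure X) (f : X → EReal) : ℝ≥0∞ :=
  (∫⁻ x, (f x).abs ^ p ∂μ +
    ⨅ (g : X → ℝ≥0∞) (_ : IsUpperGradient f g), ∫⁻ x, g x ^ p ∂μ) ^ (1 / p)

/-- Membership in the Newtonian space `N^{1,p}(X)`. Functions are defined everywhere. -/
def MemNewtonian (p : ℝ) (μ : Measure X) (f : X → EReal) : Prop :=
  AEMeasurable f μ ∧ newtonianNorm p μ f < ⊤

/-- `u` is admissible for the variational capacity of `E` in `Ω`. -/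
def IsAdmissible (p : ℝ) (μ : Measure X) (E Ω : Set X) (u : X → EReal) : Prop :=
  MemNewtonian p μ u ∧ (∀ x ∈ Ω, E.indicator 1 x ≤ u x ∧ u x ≤ 1) ∧ ∀ x ∉ Ω, u x = 0

/-- The variational `p`-capacity `cap_p(E, Ω) = inf_u ∫_Ω g_u^p dμ` over the admissible `u`, where
`g_u` is the (a.e. unique) minimal `p`-weak upper gradient of `u`. -/
noncomputable def variationalCapacity (p : ℝ) (μ : Measure X) (E Ω : Set X) : ℝ≥0∞ :=
  ⨅ (u : X → EReal) (_ : IsAdmissible p μ E Ω u)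
    (g : X → ℝ≥0∞) (_ : IsMinimalWeakUpperGradient p μ u g), ∫⁻ x in Ω, g x ^ p ∂μ

/-- `μ` is globally doubling with constant `C`. -/
def IsDoublingWith (C : ℝ) (μ : Measure X) : Prop :=
  ∀ (x : X) (r : ℝ), 0 < r → μ (ball x (2 * r)) ≤ ENNReal.ofReal C * μ (ball x r)

/-- The global `p`-Poincaré inequality with constant `C` and dilation `lam`. -/
def SupportsPoincareWith (p C lam : ℝ) (μ : Measure X) : Prop :=
  ∀ (x : X) (r : ℝ), 0 < r →
    ∀ f : X → EReal, AEMeasurable f μ → ∫⁻ y, (f y).abs ∂μ < ⊤ →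
      ∀ g : X → ℝ≥0∞, IsUpperGradient f g →
        ⨍⁻ y in ball x r, (f y - ((⨍ z in ball x r, (f z).toReal ∂μ : ℝ) : EReal)).abs ∂μ
          ≤ ENNReal.ofReal (C * r) * (⨍⁻ y in ball x (lam * r), g y ^ p ∂μ) ^ (1 / p)

end MetricSobolev

/-! Write δ = R - r. For the upper bound, the radial cutoff is admissible and has the upper gradient
1/δ on the annulus and 0 elsewhere. The capacity only tests minimal weak upper gradients, so one
must exist for the cutoff. For a Lipschitz function v, an L^p function g is a weak upper gradient
exactly when |(v ∘ γ)'| ≤ g ∘ γ a.e. on almost every curve γ. This pointwise condition survives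
countable infima, so the infimum of an energy-minimizing sequence is minimal
(`exists_isMinimalWeakUpperGradient`).

For the lower bound, let v be admissible and x a point of the annulus. The ball B(x, 2δ) contains a
ball of radius aδ on which v = 1 and another on which v = 0. By doubling, both carry a fixed share
of its measure. The Poincaré inequality then gives 1 ≤ C δ^p ⨍ G^p over B(x, 2λδ) for every upper
gradient G. Integrating over the annulus and exchanging the integrals
(`measure_le_of_one_le_mul_laverage`) bounds its measure by C δ^p ∫ G^p, with no covering argument.
Since v vanishes off B_R, `iInf_lintegral_upperGradient_le` replaces the energy of G by that of the
minimal weak upper gradient inside B_R. -/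

namespace MetricSobolev

universe u

/-! ### Curves, exceptional families and weak upper gradients. -/

section Curves

variable {X : Type u} [MetricSpace X]

lemma ArcCurve.lipschitzOnWith (γ : ArcCurve X) :
    LipschitzOnWith 1 γ.toFun (Icc 0 γ.length) := by
  intro s hs t ht
  wlog hst : s ≤ t generalizing s t
  · rw [edist_comm, edist_comm s]
    exact this ht hs (le_of_not_ge hst)
  have h := eVariationOn.edist_le γ.toFun (s := Icc 0 γ.length ∩ Icc s t) (x := s) (y := t)
    ⟨hs, ⟨le_rfl, hst⟩⟩ ⟨ht, ⟨hst, le_rfl⟩⟩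
  rw [γ.unitSpeed hs ht] at h
  refine h.trans ?_
  rw [edist_comm, edist_dist, Real.dist_eq, abs_of_nonneg (sub_nonneg.2 hst)]
  simp

lemma ArcCurve.continuousOn (γ : ArcCurve X) : ContinuousOn γ.toFun (Icc 0 γ.length) :=
  γ.lipschitzOnWith.continuousOn

/-- The restriction of a curve to `[s, t]`, with the parameter shifted to start at `0`. -/
def ArcCurve.subcurve (γ : ArcCurve X) {s t : ℝ} (hs : 0 ≤ s) (hst : s < t)
    (ht : t ≤ γ.length) : ArcCurve X where
  length := t - s
  toFun τ := γ.toFun (s + τ)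
  length_pos := sub_pos.2 hst
  unitSpeed := by
    intro x hx y hy
    have hmono : Monotone (fun τ : ℝ => s + τ) := fun _ _ h => by simpa using h
    have h1 := eVariationOn.comp_inter_Icc_eq_of_monotoneOn γ.toFun (t := Icc 0 (t - s))
      (fun τ => s + τ) (hmono.monotoneOn _) hx hy
    have h2 : (fun τ => γ.toFun (s + τ)) = γ.toFun ∘ (fun τ => s + τ) := rfl
    rw [h2, h1]
    have hx' : s + x ∈ Icc 0 γ.length := ⟨by linarith [hx.1], by linarith [hx.2]⟩
    have hy' : s + y ∈ Icc 0 γ.length := ⟨by linarith [hy.1], by linarith [hy.2]⟩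
    have h3 := γ.unitSpeed hx' hy'
    have h4 : (fun τ : ℝ => s + τ) '' Icc 0 (t - s) = Icc s t := by
      rw [image_const_add_Icc]; simp
    have h5 : Icc s t ∩ Icc (s + x) (s + y) = Icc 0 γ.length ∩ Icc (s + x) (s + y) := by
      ext τ
      simp only [mem_inter_iff, mem_Icc]
      constructor
      · rintro ⟨⟨h1, h2⟩, h3, h4⟩
        exact ⟨⟨by linarith, by linarith⟩, h3, h4⟩
      · rintro ⟨_, h3, h4⟩
        exact ⟨⟨by linarith [hx.1], by linarith [hy.2]⟩, h3, h4⟩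
    rw [h4, h5, h3]
    congr 2
    ring

lemma ArcCurve.lineIntegral_subcurve (γ : ArcCurve X) {s t : ℝ} (hs : 0 ≤ s) (hst : s < t)
    (ht : t ≤ γ.length) (g : X → ℝ≥0∞) :
    (γ.subcurve hs hst ht).lineIntegral g = ∫⁻ τ in Icc s t, g (γ.toFun τ) := by
  have h := (measurePreserving_add_left (volume : Measure ℝ) s).setLIntegral_comp_emb
    (measurableEmbedding_addLeft s) (fun τ => g (γ.toFun τ)) (Icc 0 (t - s))
  rw [image_const_add_Icc] at h
  simpa [ArcCurve.lineIntegral, ArcCurve.subcurve] using h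

lemma ArcCurve.lineIntegral_subcurve_le (γ : ArcCurve X) {s t : ℝ} (hs : 0 ≤ s) (hst : s < t)
    (ht : t ≤ γ.length) (g : X → ℝ≥0∞) :
    (γ.subcurve hs hst ht).lineIntegral g ≤ γ.lineIntegral g := by
  rw [γ.lineIntegral_subcurve]
  exact lintegral_mono_set (Icc_subset_Icc hs ht)

lemma ArcCurve.lineIntegral_mono (γ : ArcCurve X) {g h : X → ℝ≥0∞} (hgh : ∀ x, g x ≤ h x) :
    γ.lineIntegral g ≤ γ.lineIntegral h :=
  lintegral_mono fun _ => hgh _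

lemma ArcCurve.lineIntegral_const_mul (γ : ArcCurve X) {c : ℝ≥0∞} (hc : c ≠ ⊤)
    (g : X → ℝ≥0∞) : γ.lineIntegral (fun x => c * g x) = c * γ.lineIntegral g :=
  lintegral_const_mul' _ _ hc

lemma ArcCurve.gradientBound_coe (γ : ArcCurve X) (v : X → ℝ) (g : X → ℝ≥0∞) :
    γ.GradientBound (fun x => (v x : EReal)) g ↔
      ‖v (γ.toFun 0) - v (γ.toFun γ.length)‖ₑ ≤ γ.lineIntegral g := by
  rw [ArcCurve.GradientBound, ← EReal.coe_sub, EReal.abs_def, Real.enorm_eq_ofReal_abs]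

variable [MeasurableSpace X]

lemma ArcCurve.aemeasurable_comp [BorelSpace X] (γ : ArcCurve X) {g : X → ℝ≥0∞}
    (hg : Measurable g) :
    AEMeasurable (fun t => g (γ.toFun t)) (volume.restrict (Icc 0 γ.length)) :=
  hg.comp_aemeasurable (γ.continuousOn.aemeasurable measurableSet_Icc)

/-- Countably many test functions can be merged into one whose line integral is finite only if
all of theirs are. -/
lemma exists_dominating_testFunction {p : ℝ} (hp : 0 < p) (μ : Measure X) {ι : Type*}
    [Countable ι] (ρ : ι → X → ℝ≥0∞) (hρ : ∀ i, Measurable (ρ i))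
    (hρp : ∀ i, ∫⁻ x, ρ i x ^ p ∂μ < ⊤) :
    ∃ σ : X → ℝ≥0∞, Measurable σ ∧ ∫⁻ x, σ x ^ p ∂μ < ⊤ ∧
      ∀ γ : ArcCurve X, γ.lineIntegral σ ≠ ⊤ → ∀ i, γ.lineIntegral (ρ i) ≠ ⊤ := by
  -- The weights make ∑ c i * ∫ ρ i ^ p finite. The ℓ^p-type sum σ below then lies in L^p and
  -- dominates each c i ^ (1/p) * ρ i.
  obtain ⟨c, hc, hsum⟩ := ENNReal.exists_pos_tsum_mul_lt_of_countable one_ne_zero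
    (fun i => ∫⁻ x, ρ i x ^ p ∂μ) (fun i => (hρp i).ne)
  have hterm : ∀ i, Measurable fun x => ρ i x ^ p * (c i : ℝ≥0∞) := fun i =>
    ((hρ i).pow_const p).mul_const _
  refine ⟨fun x => (∑' i, ρ i x ^ p * (c i : ℝ≥0∞)) ^ p⁻¹,
    (Measurable.tsum hterm).pow_const _, ?_, ?_⟩
  · simp_rw [← ENNReal.rpow_mul, inv_mul_cancel₀ hp.ne', ENNReal.rpow_one]
    rw [lintegral_tsum fun i => (hterm i).aemeasurable]
    simp_rw [lintegral_mul_const _ ((hρ _).pow_const p)]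
    exact hsum.trans ENNReal.one_lt_top
  · intro γ hγ i hi
    have hci : (c i : ℝ≥0∞) ≠ 0 := by exact_mod_cast (hc i).ne'
    have hC : ((c i : ℝ≥0∞) ^ p⁻¹) ≠ ⊤ :=
      ENNReal.rpow_ne_top_of_nonneg (inv_nonneg.2 hp.le) ENNReal.coe_ne_top
    have hC0 : ((c i : ℝ≥0∞) ^ p⁻¹) ≠ 0 := by
      simp [ENNReal.rpow_eq_zero_iff, hci]
    apply hγ
    rw [eq_top_iff]
    calc (⊤ : ℝ≥0∞) = (c i : ℝ≥0∞) ^ p⁻¹ * γ.lineIntegral (ρ i) := by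
          rw [hi, ENNReal.mul_top hC0]
      _ = γ.lineIntegral fun x => (c i : ℝ≥0∞) ^ p⁻¹ * ρ i x :=
          (γ.lineIntegral_const_mul hC _).symm
      _ ≤ _ := by
          refine γ.lineIntegral_mono fun x => ?_
          rw [ENNReal.le_rpow_inv_iff hp, ENNReal.mul_rpow_of_nonneg _ _ hp.le,
            ← ENNReal.rpow_mul, inv_mul_cancel₀ hp.ne', ENNReal.rpow_one, mul_comm]
          exact ENNReal.le_tsum i

/-- A null set is met in length zero by all curves outside a family of zero modulus. -/
lemma exists_testFunction_of_ae {p : ℝ} (hp : 0 < p) [BorelSpace X] (μ : Measure X)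
    {P : X → Prop} (hP : ∀ᵐ x ∂μ, P x) :
    ∃ σ : X → ℝ≥0∞, Measurable σ ∧ ∫⁻ x, σ x ^ p ∂μ < ⊤ ∧
      ∀ γ : ArcCurve X, γ.lineIntegral σ ≠ ⊤ →
        ∀ᵐ t ∂volume.restrict (Icc 0 γ.length), P (γ.toFun t) := by
  have hN : MeasurableSet (toMeasurable μ {x | ¬ P x}) := measurableSet_toMeasurable _ _
  have hμN : μ (toMeasurable μ {x | ¬ P x}) = 0 := by rw [measure_toMeasurable]; exact hP
  have hm : Measurable ((toMeasurable μ {x | ¬ P x}).indicator fun _ => (⊤ : ℝ≥0∞)) :=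
    measurable_const.indicator hN
  -- σ is ∞ on a Borel null set containing the bad points, so it has zero energy, and a finite line
  -- integral forces γ to avoid that set for a.e. parameter.
  refine ⟨(toMeasurable μ {x | ¬ P x}).indicator fun _ => ⊤, hm, ?_, ?_⟩
  · have : ∫⁻ x, ((toMeasurable μ {x | ¬ P x}).indicator (fun _ => (⊤ : ℝ≥0∞)) x) ^ p ∂μ = 0 := by
      rw [lintegral_eq_zero_iff (hm.pow_const p)]
      filter_upwards [measure_eq_zero_iff_ae_notMem.1 hμN] with x hx
      simp [hx, hp]
    simp [this]
  · intro γ hγ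
    filter_upwards [ae_lt_top' (γ.aemeasurable_comp hm) hγ] with t ht
    by_contra hPt
    have := subset_toMeasurable μ {x | ¬ P x} hPt
    simp [this] at ht

/-- A weak upper gradient bounds the oscillation of the function along all subarcs of each curve
outside a family of zero modulus. -/
lemma IsWeakUpperGradient.exists_subarc_bound {p : ℝ} {μ : Measure X} {v : X → ℝ}
    {g : X → ℝ≥0∞} (hg : IsWeakUpperGradient p μ (fun x => (v x : EReal)) g) :
    ∃ σ : X → ℝ≥0∞, Measurable σ ∧ ∫⁻ x, σ x ^ p ∂μ < ⊤ ∧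
      ∀ γ : ArcCurve X, γ.lineIntegral σ ≠ ⊤ → ∀ s t, 0 ≤ s → s ≤ t → t ≤ γ.length →
        ‖v (γ.toFun s) - v (γ.toFun t)‖ₑ ≤ ∫⁻ τ in Icc s t, g (γ.toFun τ) := by
  obtain ⟨-, σ, hσ, hσp, hΓ⟩ := hg
  refine ⟨σ, hσ, hσp, fun γ hγ s t hs hst ht => ?_⟩
  rcases hst.eq_or_lt with rfl | hst
  · simp
  -- A bad subarc would have infinite σ-integral, and then so would γ.
  have h1 : (γ.subcurve hs hst ht).GradientBound (fun x => (v x : EReal)) g := by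
    by_contra hb
    exact hγ (eq_top_iff.2 ((hΓ _ hb).symm.le.trans (γ.lineIntegral_subcurve_le hs hst ht σ)))
  rw [ArcCurve.gradientBound_coe, γ.lineIntegral_subcurve] at h1
  simpa [ArcCurve.subcurve] using h1

/-- Being a weak upper gradient does not depend on the choice of representative. -/
lemma IsWeakUpperGradient.congr_ae {p : ℝ} (hp : 0 < p) [BorelSpace X] {μ : Measure X}
    {f : X → EReal} {g g' : X → ℝ≥0∞} (hg : IsWeakUpperGradient p μ f g) (hgg' : g =ᵐ[μ] g') :
    IsWeakUpperGradient p μ f g' := by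
  obtain ⟨hgm, ρ, hρ, hρp, hΓ⟩ := hg
  obtain ⟨σ, hσ, hσp, hae⟩ := exists_testFunction_of_ae hp μ hgg'
  obtain ⟨τ, hτ, hτp, hfin⟩ := exists_dominating_testFunction hp μ
    (fun b : Bool => if b then ρ else σ) (by rintro (_ | _) <;> simpa)
    (by rintro (_ | _) <;> simpa)
  refine ⟨hgm.congr hgg', τ, hτ, hτp, fun γ hγ => ?_⟩
  by_contra hfinτ
  have h1 : γ.lineIntegral ρ ≠ ⊤ := by simpa using hfin γ hfinτ true
  have h2 : γ.lineIntegral σ ≠ ⊤ := by simpa using hfin γ hfinτ false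
  apply hγ
  have hb : γ.GradientBound f g := by
    by_contra hb
    exact h1 (hΓ γ hb)
  have : γ.lineIntegral g = γ.lineIntegral g' := lintegral_congr_ae (hae γ h2)
  rwa [ArcCurve.GradientBound, ← this]

lemma IsUpperGradient.isWeakUpperGradient {p : ℝ} (hp : 0 < p) {μ : Measure X}
    {f : X → EReal} {g : X → ℝ≥0∞} (hg : IsUpperGradient f g) : IsWeakUpperGradient p μ f g :=
  ⟨hg.1.aemeasurable, 0, measurable_zero, by simp [hp], fun γ hγ => absurd (hg.2 γ) hγ⟩

end Curves

/-! ### Derivatives along curves and existence of minimal weak upper gradients. -/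

section MinimalGradient

variable {X : Type u} [MetricSpace X]

lemma ArcCurve.lipschitzOnWith_comp (γ : ArcCurve X) {K : ℝ≥0} {v : X → ℝ}
    (hv : LipschitzWith K v) :
    LipschitzOnWith K (fun t => v (γ.toFun t)) (Icc 0 γ.length) := by
  have h := (hv.lipschitzOnWith (s := univ)).comp γ.lipschitzOnWith (mapsTo_univ _ _)
  rwa [mul_one] at h

/-- A bound for the derivative of a Lipschitz function along a curve gives the gradient bound. -/
lemma ArcCurve.gradientBound_of_deriv_le (γ : ArcCurve X) {K : ℝ≥0} {v : X → ℝ}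
    (hv : LipschitzWith K v) {g : X → ℝ≥0∞}
    (h : ∀ᵐ t ∂volume.restrict (Icc 0 γ.length),
      ‖deriv (fun t => v (γ.toFun t)) t‖ₑ ≤ g (γ.toFun t)) :
    γ.GradientBound (fun x => (v x : EReal)) g := by
  have hL := γ.lipschitzOnWith_comp hv
  rw [← uIcc_of_le γ.length_pos.le] at hL
  have hftc := hL.absolutelyContinuousOnInterval.integral_deriv_eq_sub
  rw [ArcCurve.gradientBound_coe, ← enorm_neg, neg_sub, ← hftc,
    intervalIntegral.integral_of_le γ.length_pos.le, ← integral_Icc_eq_integral_Ioc]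
  exact (enorm_integral_le_lintegral_enorm _).trans (lintegral_mono_ae h)

lemma deriv_nonneg_of_monotoneOn {f : ℝ → ℝ} {f' a b t : ℝ} (hf : MonotoneOn f (Icc a b))
    (ht : t ∈ Ioo a b) (h : HasDerivAt f f' t) : 0 ≤ f' := by
  have hmem : Icc a b ∈ nhds t := Icc_mem_nhds ht.1 ht.2
  refine HasDerivWithinAt.nonneg_of_monotoneOn (s := Icc a b) ?_ h.hasDerivWithinAt hf
  simpa using (PerfectSpace.univ_preperfect t (mem_univ t)).nhds_inter hmem

/-- A function whose oscillation is bounded by the integral of `h` has derivative at most `h`. -/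
lemma ae_enorm_deriv_le {φ : ℝ → ℝ} {l : ℝ} {h : ℝ → ℝ≥0∞}
    (hm : AEMeasurable h (volume.restrict (Icc 0 l)))
    (hfin : ∫⁻ t in Icc 0 l, h t ≠ ⊤)
    (hφ : ∀ s t, 0 ≤ s → s ≤ t → t ≤ l → ‖φ s - φ t‖ₑ ≤ ∫⁻ τ in Icc s t, h τ) :
    ∀ᵐ t ∂volume.restrict (Icc 0 l), ‖deriv φ t‖ₑ ≤ h t := by
  rcases le_total l 0 with hl | hl
  · have : volume (Icc 0 l) = 0 := by simp [hl]
    simp [Measure.restrict_eq_zero.2 this]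
  have hint : IntegrableOn (fun t => (h t).toReal) (Icc 0 l) :=
    integrable_toReal_of_lintegral_ne_top hm hfin
  have hii : IntervalIntegrable (fun t => (h t).toReal) volume 0 l := by
    rw [intervalIntegrable_iff_integrableOn_Icc_of_le hl]; exact hint
  have hsub : ∀ s t, 0 ≤ s → s ≤ t → t ≤ l →
      IntervalIntegrable (fun t => (h t).toReal) volume s t := fun s t hs hst ht =>
    hii.mono_set (by rw [uIcc_of_le hst, uIcc_of_le hl]; exact Icc_subset_Icc hs ht)
  -- Both H - φ and H + φ are monotone for this primitive H, so |φ'| ≤ H' = h wherever the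
  -- derivatives exist.
  set H : ℝ → ℝ := fun t => ∫ τ in (0 : ℝ)..t, (h τ).toReal with hH
  have hHsub : ∀ s t, 0 ≤ s → s ≤ t → t ≤ l → |φ s - φ t| ≤ H t - H s := by
    intro s t hs hst ht
    have h1 : H t - H s = ∫ τ in s..t, (h τ).toReal :=
      intervalIntegral.integral_interval_sub_left (hsub 0 t le_rfl (hs.trans hst) ht)
        (hsub 0 s le_rfl hs (hst.trans ht))
    have hmst : AEMeasurable h (volume.restrict (Icc s t)) :=
      hm.mono_measure (Measure.restrict_mono (Icc_subset_Icc hs ht) le_rfl)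
    have hfst : ∫⁻ τ in Icc s t, h τ ≠ ⊤ :=
      ne_top_of_le_ne_top hfin (lintegral_mono_set (Icc_subset_Icc hs ht))
    rw [h1, intervalIntegral.integral_of_le hst, ← integral_Icc_eq_integral_Ioc,
      integral_toReal hmst (ae_lt_top' hmst hfst), ← Real.norm_eq_abs, ← toReal_enorm]
    exact ENNReal.toReal_mono hfst (hφ s t hs hst ht)
  have hHd := hii.ae_hasDerivAt_integral
  rw [← restrict_Ioo_eq_restrict_Icc, ae_restrict_iff' measurableSet_Ioo]
  filter_upwards [hHd] with t ht hmem
  by_cases hd : DifferentiableAt ℝ φ t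
  · have hHt : HasDerivAt H (h t).toReal t :=
      ht (by rw [uIcc_of_le hl]; exact Ioo_subset_Icc_self hmem) 0 (by simp)
    have h1 := deriv_nonneg_of_monotoneOn (f := H - φ) (a := 0) (b := l)
      (fun a ha b hb hab => by
        have := abs_le.1 (hHsub a b ha.1 hab hb.2)
        simp only [Pi.sub_apply]; linarith) hmem (hHt.sub hd.hasDerivAt)
    have h2 := deriv_nonneg_of_monotoneOn (f := H + φ) (a := 0) (b := l)
      (fun a ha b hb hab => by
        have := abs_le.1 (hHsub a b ha.1 hab hb.2)
        simp only [Pi.add_apply]; linarith) hmem (hHt.add hd.hasDerivAt)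
    rw [Real.enorm_eq_ofReal_abs]
    refine (ENNReal.ofReal_le_ofReal ?_).trans ENNReal.ofReal_toReal_le
    exact abs_le.2 ⟨by linarith, by linarith⟩
  -- `deriv` takes the value 0 here, so φ need not be differentiable anywhere.
  · simp [deriv_zero_of_not_differentiableAt hd]

variable [MeasurableSpace X]

/-- Along all curves outside a family of zero modulus, `g` bounds the derivative of `v`. -/
def IsDerivBound (p : ℝ) (μ : Measure X) (v : X → ℝ) (g : X → ℝ≥0∞) : Prop :=
  ∃ ρ : X → ℝ≥0∞, Measurable ρ ∧ ∫⁻ x, ρ x ^ p ∂μ < ⊤ ∧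
    ∀ γ : ArcCurve X, γ.lineIntegral ρ ≠ ⊤ → ∀ᵐ t ∂volume.restrict (Icc 0 γ.length),
      ‖deriv (fun t => v (γ.toFun t)) t‖ₑ ≤ g (γ.toFun t)

/-- The Lipschitz hypothesis makes v absolutely continuous along each curve, so its derivative can
be integrated back. -/
lemma IsDerivBound.isWeakUpperGradient {p : ℝ} {μ : Measure X} {K : ℝ≥0} {v : X → ℝ}
    (hv : LipschitzWith K v) {g : X → ℝ≥0∞} (hg : AEMeasurable g μ)
    (h : IsDerivBound p μ v g) : IsWeakUpperGradient p μ (fun x => (v x : EReal)) g := by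
  obtain ⟨ρ, hρ, hρp, hγ⟩ := h
  refine ⟨hg, ρ, hρ, hρp, fun γ hb => ?_⟩
  by_contra hfin
  exact hb (γ.gradientBound_of_deriv_le hv (hγ γ hfin))

lemma IsWeakUpperGradient.isDerivBound {p : ℝ} (hp : 0 < p) [BorelSpace X] {μ : Measure X}
    {v : X → ℝ} {g : X → ℝ≥0∞} (hg : Measurable g) (hgp : ∫⁻ x, g x ^ p ∂μ < ⊤)
    (h : IsWeakUpperGradient p μ (fun x => (v x : EReal)) g) : IsDerivBound p μ v g := by
  obtain ⟨σ, hσ, hσp, hsub⟩ := h.exists_subarc_bound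
  -- Being in L^p, g itself serves as a test function: its line integral is finite off an
  -- exceptional family, as differentiation of that integral requires.
  obtain ⟨τ, hτ, hτp, hfin⟩ := exists_dominating_testFunction hp μ
    (fun b : Bool => if b then σ else g) (by rintro (_ | _) <;> simpa)
    (by rintro (_ | _) <;> simpa)
  refine ⟨τ, hτ, hτp, fun γ hγ => ?_⟩
  have h1 : γ.lineIntegral σ ≠ ⊤ := by simpa using hfin γ hγ true
  have h2 : γ.lineIntegral g ≠ ⊤ := by simpa using hfin γ hγ false
  exact ae_enorm_deriv_le (γ.aemeasurable_comp hg) h2 (hsub γ h1)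

/-- Countably many exceptional families and countably many null sets of parameters can be discarded
together. The integrated gradient inequality has no such direct closure under infima. -/
lemma IsDerivBound.iInf {p : ℝ} (hp : 0 < p) {μ : Measure X} {v : X → ℝ} {ι : Type*}
    [Countable ι] {g : ι → X → ℝ≥0∞} (h : ∀ i, IsDerivBound p μ v (g i)) :
    IsDerivBound p μ v (fun x => ⨅ i, g i x) := by
  choose ρ hρ hρp hγ using h
  obtain ⟨σ, hσ, hσp, hfin⟩ := exists_dominating_testFunction hp μ ρ hρ hρp
  refine ⟨σ, hσ, hσp, fun γ hσγ => ?_⟩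
  filter_upwards [ae_all_iff.2 fun i => hγ i γ (hfin γ hσγ i)] with t ht
  exact le_iInf ht

lemma IsDerivBound.inf {p : ℝ} (hp : 0 < p) {μ : Measure X} {v : X → ℝ}
    {g g' : X → ℝ≥0∞} (h : IsDerivBound p μ v g) (h' : IsDerivBound p μ v g') :
    IsDerivBound p μ v (fun x => g x ⊓ g' x) := by
  have := IsDerivBound.iInf hp (g := fun b : Bool => if b then g else g')
    (by rintro (_ | _) <;> simpa)
  simpa [iInf_bool_eq] using this

/-- A Lipschitz function with a weak upper gradient in `L^p` has a minimal one. -/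
theorem exists_isMinimalWeakUpperGradient {p : ℝ} (hp : 0 < p) [BorelSpace X] {μ : Measure X}
    {K : ℝ≥0} {v : X → ℝ} (hv : LipschitzWith K v) {g₀ : X → ℝ≥0∞} (hg₀ : Measurable g₀)
    (hg₀p : ∫⁻ x, g₀ x ^ p ∂μ < ⊤)
    (hw : IsWeakUpperGradient p μ (fun x => (v x : EReal)) g₀) :
    ∃ g, IsMinimalWeakUpperGradient p μ (fun x => (v x : EReal)) g := by
  let S : Set ℝ≥0∞ := {c | ∃ g : X → ℝ≥0∞, Measurable g ∧ IsDerivBound p μ v g ∧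
    c = ∫⁻ x, g x ^ p ∂μ}
  have hmem₀ : ∫⁻ x, g₀ x ^ p ∂μ ∈ S := ⟨g₀, hg₀, hw.isDerivBound hp hg₀ hg₀p, rfl⟩
  obtain ⟨c, -, hc, hcS⟩ := exists_seq_tendsto_sInf (S := S) ⟨_, hmem₀⟩ (OrderBot.bddBelow _)
  choose g hg hgb hgc using hcS
  set G : X → ℝ≥0∞ := fun x => ⨅ n, g n x with hG
  have hGm : Measurable G := Measurable.iInf hg
  have hGb : IsDerivBound p μ v G := IsDerivBound.iInf hp hgb
  have hGle : ∫⁻ x, G x ^ p ∂μ ≤ sInf S := by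
    refine ge_of_tendsto' hc fun n => ?_
    rw [hgc n]
    exact lintegral_mono fun x => ENNReal.rpow_le_rpow (iInf_le _ n) hp.le
  have hGp : ∫⁻ x, G x ^ p ∂μ < ⊤ := (hGle.trans (sInf_le hmem₀)).trans_lt hg₀p
  refine ⟨G, hGb.isWeakUpperGradient hv hGm.aemeasurable, hGp, fun g' hg' hg'p => ?_⟩
  have hae : g' =ᵐ[μ] hg'.1.mk g' := hg'.1.ae_eq_mk
  have hkm := hg'.1.measurable_mk
  set k := hg'.1.mk g'
  have hkb : IsDerivBound p μ v k := by
    refine (hg'.congr_ae hp hae).isDerivBound hp hkm ?_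
    exact (lintegral_congr_ae (hae.symm.fun_comp (· ^ p))).trans_lt hg'p
  -- The minimum of G and k is again a competitor, so its energy cannot be below that of G; hence
  -- the two agree a.e.
  have hmin : (fun x => (G x ⊓ k x) ^ p) =ᵐ[μ] fun x => G x ^ p := by
    refine ae_eq_of_ae_le_of_lintegral_le (Filter.Eventually.of_forall fun x =>
      ENNReal.rpow_le_rpow inf_le_left hp.le) ?_ (hGm.pow_const p).aemeasurable ?_
    · exact ne_top_of_le_ne_top hGp.ne
        (lintegral_mono fun x => ENNReal.rpow_le_rpow inf_le_left hp.le)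
    · exact hGle.trans (sInf_le ⟨_, hGm.inf hkm, hGb.inf hp hkb, rfl⟩)
  filter_upwards [hmin, hae] with x hx hx'
  rw [hx', ← ENNReal.rpow_left_injective hp.ne' hx]
  exact inf_le_right

end MinimalGradient

/-! ### Upper bound by the radial cutoff. -/

section UpperBound

variable {X : Type u} [MetricSpace X]

/-- The radial cutoff function that is `1` on `ball x₀ r` and `0` off `ball x₀ R`. -/
noncomputable def cutoff (x₀ : X) (r R : ℝ) (x : X) : ℝ :=
  max 0 (min 1 ((R - dist x x₀) / (R - r)))

lemma cutoff_nonneg (x₀ : X) (r R : ℝ) (x : X) : 0 ≤ cutoff x₀ r R x := le_max_left _ _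

lemma cutoff_le_one (x₀ : X) (r R : ℝ) (x : X) : cutoff x₀ r R x ≤ 1 :=
  max_le zero_le_one (min_le_left _ _)

lemma cutoff_eq_one {x₀ : X} {r R : ℝ} (hrR : r < R) {x : X} (hx : x ∈ ball x₀ r) :
    cutoff x₀ r R x = 1 := by
  have h : 1 ≤ (R - dist x x₀) / (R - r) := by
    rw [one_le_div (sub_pos.2 hrR)]; linarith [mem_ball.1 hx]
  rw [cutoff, min_eq_left h, max_eq_right zero_le_one]

lemma cutoff_eq_zero {x₀ : X} {r R : ℝ} (hrR : r < R) {x : X} (hx : x ∉ ball x₀ R) :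
    cutoff x₀ r R x = 0 := by
  have h : (R - dist x x₀) / (R - r) ≤ 0 :=
    div_nonpos_of_nonpos_of_nonneg (by have := not_lt.1 (mt mem_ball.2 hx); linarith)
      (sub_pos.2 hrR).le
  rw [cutoff, max_eq_left ((min_le_right _ _).trans h)]

lemma cutoff_lipschitzWith (x₀ : X) {r R : ℝ} (hrR : r < R) :
    LipschitzWith (R - r)⁻¹.toNNReal (cutoff x₀ r R) := by
  have h1 : LipschitzWith (R - r)⁻¹.toNNReal fun x : X => (R - dist x x₀) / (R - r) := by
    refine LipschitzWith.of_dist_le_mul fun x y => ?_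
    rw [Real.coe_toNNReal _ (inv_nonneg.2 (sub_pos.2 hrR).le), Real.dist_eq, ← sub_div, abs_div,
      abs_of_pos (sub_pos.2 hrR), div_eq_inv_mul]
    refine mul_le_mul_of_nonneg_left ?_ (inv_nonneg.2 (sub_pos.2 hrR).le)
    rw [sub_sub_sub_cancel_left, abs_sub_comm]
    exact abs_dist_sub_le x y x₀
  exact (h1.const_min 1).const_max 0

/-- The upper gradient of the cutoff function. -/
noncomputable def cutoffGradient (x₀ : X) (r R : ℝ) : X → ℝ≥0∞ :=
  (ball x₀ R \ ball x₀ r).indicator fun _ => ENNReal.ofReal (R - r)⁻¹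

variable [MeasurableSpace X] [BorelSpace X]

lemma measurable_cutoffGradient (x₀ : X) (r R : ℝ) : Measurable (cutoffGradient x₀ r R) :=
  measurable_const.indicator (measurableSet_ball.diff measurableSet_ball)

lemma cutoffGradient_isUpperGradient (x₀ : X) {r R : ℝ} (hrR : r < R) :
    IsUpperGradient (fun x => (cutoff x₀ r R x : EReal)) (cutoffGradient x₀ r R) := by
  refine ⟨measurable_cutoffGradient x₀ r R, fun γ => ?_⟩
  have hL := cutoff_lipschitzWith x₀ hrR
  refine γ.gradientBound_of_deriv_le hL ?_
  rw [← restrict_Ioo_eq_restrict_Icc, ae_restrict_iff' measurableSet_Ioo]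
  refine Filter.Eventually.of_forall fun t ht => ?_
  by_cases hR : γ.toFun t ∈ ball x₀ R
  · by_cases hr : γ.toFun t ∈ ball x₀ r
    -- The cutoff attains its extreme value 1 here (and 0 in the last case), so the derivative
    -- vanishes. No local constancy is needed, which settles points on the sphere of radius R.
    · have hmax : IsLocalMax (fun t => cutoff x₀ r R (γ.toFun t)) t :=
        Filter.Eventually.of_forall fun s => by
          simp only [cutoff_eq_one hrR hr]; exact cutoff_le_one _ _ _ _
      simp [hmax.deriv_eq_zero]
    · have hS : γ.toFun t ∈ ball x₀ R \ ball x₀ r := ⟨hR, hr⟩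
      rw [cutoffGradient, indicator_of_mem hS]
      have h := norm_deriv_le_of_lipschitzOn (Icc_mem_nhds ht.1 ht.2) (γ.lipschitzOnWith_comp hL)
      rw [← ofReal_norm]
      refine ENNReal.ofReal_le_ofReal (h.trans ?_)
      rw [Real.coe_toNNReal _ (inv_nonneg.2 (sub_pos.2 hrR).le)]
  · have hmin : IsLocalMin (fun t => cutoff x₀ r R (γ.toFun t)) t :=
      Filter.Eventually.of_forall fun s => by
        simp only [cutoff_eq_zero hrR hR]; exact cutoff_nonneg _ _ _ _
    simp [hmin.deriv_eq_zero]

lemma lintegral_cutoffGradient_rpow {p : ℝ} (hp : 0 < p) (μ : Measure X) (x₀ : X) {r R : ℝ}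
    (hrR : r < R) :
    ∫⁻ x, cutoffGradient x₀ r R x ^ p ∂μ =
      μ (ball x₀ R \ ball x₀ r) / ENNReal.ofReal ((R - r) ^ p) := by
  have h : (fun x => cutoffGradient x₀ r R x ^ p) =
      (ball x₀ R \ ball x₀ r).indicator fun _ => (ENNReal.ofReal ((R - r) ^ p))⁻¹ := by
    ext x
    by_cases hx : x ∈ ball x₀ R \ ball x₀ r
    · rw [cutoffGradient, indicator_of_mem hx, indicator_of_mem hx,
        ENNReal.ofReal_inv_of_pos (sub_pos.2 hrR), ENNReal.inv_rpow,
        ENNReal.ofReal_rpow_of_pos (sub_pos.2 hrR)]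
    · rw [cutoffGradient, indicator_of_notMem hx, indicator_of_notMem hx,
        ENNReal.zero_rpow_of_pos hp]
  rw [h, lintegral_indicator_const (measurableSet_ball.diff measurableSet_ball), mul_comm,
    ENNReal.div_eq_inv_mul, mul_comm, mul_comm]

lemma lintegral_cutoffGradient_rpow_lt_top {p : ℝ} (hp : 0 < p) {μ : Measure X} {x₀ : X}
    {r R : ℝ} (hrR : r < R) (hμ : μ (ball x₀ R) < ⊤) :
    ∫⁻ x, cutoffGradient x₀ r R x ^ p ∂μ < ⊤ := by
  rw [lintegral_cutoffGradient_rpow hp μ x₀ hrR]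
  refine ENNReal.div_lt_top ?_ ?_
  · exact ne_top_of_le_ne_top hμ.ne (measure_mono sdiff_subset)
  · simpa using Real.rpow_pos_of_pos (sub_pos.2 hrR) p

lemma cutoff_isAdmissible {p : ℝ} (hp : 0 < p) {μ : Measure X} {x₀ : X} {r R : ℝ} (hrR : r < R)
    (hμ : μ (ball x₀ R) < ⊤) :
    IsAdmissible p μ (ball x₀ r) (ball x₀ R) (fun x => (cutoff x₀ r R x : EReal)) := by
  have hle : ∀ x, ((cutoff x₀ r R x : ℝ) : EReal).abs ≤ (ball x₀ R).indicator 1 x := by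
    intro x
    rw [EReal.abs_def, abs_of_nonneg (cutoff_nonneg _ _ _ _)]
    by_cases hx : x ∈ ball x₀ R
    · simpa [hx] using cutoff_le_one x₀ r R x
    · simp [hx, cutoff_eq_zero hrR hx]
  have h1 : ∫⁻ x, ((cutoff x₀ r R x : ℝ) : EReal).abs ^ p ∂μ < ⊤ := by
    refine lt_of_le_of_lt (lintegral_mono fun x => ENNReal.rpow_le_rpow (hle x) hp.le) ?_
    have : (fun x => ((ball x₀ R).indicator (1 : X → ℝ≥0∞) x) ^ p) =
        (ball x₀ R).indicator 1 := by
      ext x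
      by_cases hx : x ∈ ball x₀ R <;> simp [hx, hp]
    rw [this, lintegral_indicator_one measurableSet_ball]
    exact hμ
  have h2 := lintegral_cutoffGradient_rpow_lt_top hp hrR hμ
  refine ⟨⟨?_, ?_⟩, fun x hx => ⟨?_, ?_⟩, fun x hx => ?_⟩
  · exact (continuous_coe_real_ereal.comp (cutoff_lipschitzWith x₀ hrR).continuous).measurable
      |>.aemeasurable
  · refine ENNReal.rpow_lt_top_of_nonneg (by positivity) (ENNReal.add_lt_top.2 ⟨h1, ?_⟩).ne
    exact (iInf₂_le _ (cutoffGradient_isUpperGradient x₀ hrR)).trans_lt h2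
  · by_cases hr : x ∈ ball x₀ r
    · simp [hr, cutoff_eq_one hrR hr]
    · simpa [hr] using cutoff_nonneg x₀ r R x
  · exact by simpa using EReal.coe_le_coe_iff.2 (cutoff_le_one x₀ r R x)
  · simp [cutoff_eq_zero hrR hx]

/-- Existence of a minimal gradient is essential: without one, the inner infimum at the cutoff would
be over an empty family and equal ⊤. -/
theorem variationalCapacity_ball_le {p : ℝ} (hp : 0 < p) {μ : Measure X} {x₀ : X} {r R : ℝ}
    (hrR : r < R) (hμ : μ (ball x₀ R) < ⊤) :
    variationalCapacity p μ (ball x₀ r) (ball x₀ R) ≤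
      μ (ball x₀ R \ ball x₀ r) / ENNReal.ofReal ((R - r) ^ p) := by
  have hug := cutoffGradient_isUpperGradient x₀ hrR
  have hI := lintegral_cutoffGradient_rpow hp μ x₀ hrR
  have h2 := lintegral_cutoffGradient_rpow_lt_top hp hrR hμ
  have hw := hug.isWeakUpperGradient hp (μ := μ)
  obtain ⟨g, hg⟩ := exists_isMinimalWeakUpperGradient hp (cutoff_lipschitzWith x₀ hrR) hug.1 h2 hw
  calc variationalCapacity p μ (ball x₀ r) (ball x₀ R)
      ≤ ∫⁻ x in ball x₀ R, g x ^ p ∂μ :=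
        iInf₂_le_of_le _ (cutoff_isAdmissible hp hrR hμ) (iInf₂_le _ hg)
    _ ≤ ∫⁻ x, g x ^ p ∂μ := setLIntegral_le_lintegral _ _
    _ ≤ ∫⁻ x, cutoffGradient x₀ r R x ^ p ∂μ := by
        refine lintegral_mono_ae ?_
        filter_upwards [hg.2.2 _ hw h2] with x hx
        exact ENNReal.rpow_le_rpow hx hp.le
    _ = _ := hI

end UpperBound

/-! ### From weak to genuine upper gradients, and integration of ball averages. -/

section LowerBound

variable {X : Type u} [MetricSpace X]

/-- If `v` vanishes off the open set `Ω`, only the part of the arcs inside `Ω` contributes. -/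
lemma ArcCurve.gradientBound_indicator (γ : ArcCurve X) {Ω : Set X} (hΩ : IsOpen Ω) {v : X → ℝ}
    (hv : ∀ x ∉ Ω, v x = 0) {g : X → ℝ≥0∞}
    (h : ∀ s t, 0 ≤ s → s ≤ t → t ≤ γ.length →
      ‖v (γ.toFun s) - v (γ.toFun t)‖ₑ ≤ ∫⁻ τ in Icc s t, g (γ.toFun τ)) :
    γ.GradientBound (fun x => (v x : EReal)) (Ω.indicator g) := by
  rw [γ.gradientBound_coe]
  have hl := γ.length_pos.le
  -- N is closed, so a first and a last time outside Ω exist. Since v = 0 at both, the stretch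
  -- between them can be ignored.
  set N : Set ℝ := Icc 0 γ.length ∩ γ.toFun ⁻¹' Ωᶜ with hN
  have hNc : IsClosed N := γ.continuousOn.preimage_isClosed_of_isClosed isClosed_Icc
    hΩ.isClosed_compl
  have hNb : BddBelow N := ⟨0, fun t ht => ht.1.1⟩
  have hNa : BddAbove N := ⟨γ.length, fun t ht => ht.1.2⟩
  rcases N.eq_empty_or_nonempty with hE | hne
  · refine (h 0 γ.length le_rfl hl le_rfl).trans_eq ?_
    refine setLIntegral_congr_fun measurableSet_Icc fun t ht => ?_
    have hmem : γ.toFun t ∈ Ω := by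
      by_contra hc
      exact (hE ▸ (⟨ht, hc⟩ : t ∈ N) : t ∈ (∅ : Set ℝ))
    simp [hmem]
  · have hs := hNc.csInf_mem hne hNb
    have ht := hNc.csSup_mem hne hNa
    set s := sInf N
    set t := sSup N
    have hst : s ≤ t := csInf_le_csSup hne hNb hNa
    have h1 : ‖v (γ.toFun 0)‖ₑ ≤ ∫⁻ τ in Ico 0 s, Ω.indicator g (γ.toFun τ) := by
      have := h 0 s le_rfl hs.1.1 hs.1.2
      rw [hv _ hs.2, sub_zero, ← restrict_Ico_eq_restrict_Icc] at this
      refine this.trans_eq (setLIntegral_congr_fun measurableSet_Ico fun τ hτ => ?_)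
      have hmem : γ.toFun τ ∈ Ω := by
        by_contra hc
        exact (csInf_le hNb ⟨⟨hτ.1, hτ.2.le.trans hs.1.2⟩, hc⟩).not_gt hτ.2
      simp [hmem]
    have h2 : ‖v (γ.toFun γ.length)‖ₑ ≤
        ∫⁻ τ in Ioc t γ.length, Ω.indicator g (γ.toFun τ) := by
      have := h t γ.length ht.1.1 ht.1.2 le_rfl
      rw [hv _ ht.2, zero_sub, enorm_neg, ← restrict_Ioc_eq_restrict_Icc] at this
      refine this.trans_eq (setLIntegral_congr_fun measurableSet_Ioc fun τ hτ => ?_)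
      have hmem : γ.toFun τ ∈ Ω := by
        by_contra hc
        exact (le_csSup hNa ⟨⟨ht.1.1.trans hτ.1.le, hτ.2⟩, hc⟩).not_gt hτ.1
      simp [hmem]
    have hdisj : Disjoint (Ico 0 s) (Ioc t γ.length) :=
      disjoint_left.2 fun τ h1 h2 => (h1.2.trans_le hst).not_gt h2.1
    calc ‖v (γ.toFun 0) - v (γ.toFun γ.length)‖ₑ
        ≤ ‖v (γ.toFun 0)‖ₑ + ‖v (γ.toFun γ.length)‖ₑ := enorm_sub_le
      _ ≤ _ := add_le_add h1 h2
      _ = ∫⁻ τ in Ico 0 s ∪ Ioc t γ.length, Ω.indicator g (γ.toFun τ) :=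
          (lintegral_union measurableSet_Ioc hdisj).symm
      _ ≤ γ.lineIntegral (Ω.indicator g) := by
          refine lintegral_mono_set (union_subset ?_ ?_)
          · exact fun τ hτ => ⟨hτ.1, hτ.2.le.trans hs.1.2⟩
          · exact fun τ hτ => ⟨ht.1.1.trans hτ.1.le, hτ.2⟩

variable [MeasurableSpace X]

/-- The energy in `Ω` of a weak upper gradient of a function vanishing off `Ω` controls the
energies of its upper gradients. -/
lemma iInf_lintegral_upperGradient_le {p : ℝ} (hp : 1 ≤ p) [BorelSpace X] {μ : Measure X}
    {Ω : Set X} (hΩ : IsOpen Ω) {v : X → ℝ} (hv : ∀ x ∉ Ω, v x = 0) {g : X → ℝ≥0∞}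
    (hg : IsWeakUpperGradient p μ (fun x => (v x : EReal)) g) :
    ⨅ (G : X → ℝ≥0∞) (_ : IsUpperGradient (fun x => (v x : EReal)) G), ∫⁻ x, G x ^ p ∂μ ≤
      2 ^ (p - 1) * ∫⁻ x in Ω, g x ^ p ∂μ := by
  have hp0 : 0 < p := zero_lt_one.trans_le hp
  have hae : g =ᵐ[μ] hg.1.mk g := hg.1.ae_eq_mk
  have hkm := hg.1.measurable_mk
  set k := hg.1.mk g
  obtain ⟨σ, hσ, hσp, hsub⟩ := (hg.congr_ae hp0 hae).exists_subarc_bound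
  have hhm : Measurable (Ω.indicator k) := hkm.indicator hΩ.measurableSet
  have hE : ∫⁻ x, Ω.indicator k x ^ p ∂μ = ∫⁻ x in Ω, g x ^ p ∂μ := by
    rw [← lintegral_indicator hΩ.measurableSet]
    refine lintegral_congr_ae ?_
    filter_upwards [hae] with x hx
    by_cases hxΩ : x ∈ Ω <;> simp [hxΩ, hx, hp0]
  refine ENNReal.le_of_forall_pos_le_add fun ε hε _ => ?_
  have hM : (2 : ℝ≥0∞) ^ (p - 1) * ∫⁻ x, σ x ^ p ∂μ ≠ ⊤ :=
    ENNReal.mul_ne_top (ENNReal.rpow_ne_top_of_nonneg (by linarith) (by simp)) hσp.ne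
  obtain ⟨n, hn, hnlt⟩ := ENNReal.exists_nnreal_pos_mul_lt hM (b := ε) (by exact_mod_cast hε.ne')
  have hn0 : ((n : ℝ≥0∞) ^ p⁻¹) ≠ 0 := by
    simp [ENNReal.rpow_eq_zero_iff, hn.ne']
  have hntop : ((n : ℝ≥0∞) ^ p⁻¹) ≠ ⊤ :=
    ENNReal.rpow_ne_top_of_nonneg (inv_nonneg.2 hp0.le) ENNReal.coe_ne_top
  -- A small multiple of σ gives every exceptional curve infinite line integral, and n was chosen so
  -- that this costs at most ε in energy.
  have hG : IsUpperGradient (fun x => (v x : EReal))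
      (fun x => Ω.indicator k x + (n : ℝ≥0∞) ^ p⁻¹ * σ x) := by
    refine ⟨hhm.add (hσ.const_mul _), fun γ => ?_⟩
    by_cases hγ : γ.lineIntegral σ = ⊤
    · refine le_top.trans ?_
      rw [← ENNReal.mul_top hn0, ← hγ, ← γ.lineIntegral_const_mul hntop]
      exact γ.lineIntegral_mono fun x => le_add_self
    · exact (γ.gradientBound_indicator hΩ hv (hsub γ hγ)).trans
        (γ.lineIntegral_mono fun x => le_self_add)
  refine (iInf₂_le _ hG).trans ?_
  calc ∫⁻ x, (Ω.indicator k x + (n : ℝ≥0∞) ^ p⁻¹ * σ x) ^ p ∂μ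
      ≤ ∫⁻ x, 2 ^ (p - 1) * (Ω.indicator k x ^ p + n * σ x ^ p) ∂μ := by
        refine lintegral_mono fun x => ?_
        refine (ENNReal.rpow_add_le_mul_rpow_add_rpow _ _ hp).trans_eq ?_
        rw [ENNReal.mul_rpow_of_nonneg _ _ hp0.le, ← ENNReal.rpow_mul, inv_mul_cancel₀ hp0.ne',
          ENNReal.rpow_one]
    _ = 2 ^ (p - 1) * ∫⁻ x in Ω, g x ^ p ∂μ + n * (2 ^ (p - 1) * ∫⁻ x, σ x ^ p ∂μ) := by
        have hm : Measurable fun x => Ω.indicator k x ^ p + n * σ x ^ p :=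
          (hhm.pow_const p).add ((hσ.pow_const p).const_mul _)
        rw [lintegral_const_mul _ hm, lintegral_add_left (hhm.pow_const p),
          lintegral_const_mul _ (hσ.pow_const p), hE]
        ring
    _ ≤ _ := by gcongr

/-- Disjoint balls of positive measure are countable for an s-finite measure, and the 5r-covering
lemma turns them into countable ε-nets. Second countability makes open subsets of X × X product
measurable, as Fubini requires. -/
lemma secondCountableTopology_of_measure_ball_pos [BorelSpace X] (μ : Measure X) [SFinite μ]
    (h : ∀ (x : X) (ρ : ℝ), 0 < ρ → 0 < μ (ball x ρ)) : SecondCountableTopology X := by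
  refine secondCountable_of_almost_dense_set fun ε hε => ?_
  obtain ⟨s, -, hs, hcov⟩ := Vitali.exists_disjoint_subfamily_covering_enlargement_closedBall
    (univ : Set X) id (fun _ => ε / 5) (ε / 5) (fun _ _ => le_rfl) 5 (by norm_num)
  refine ⟨s, ?_, fun x => ?_⟩
  · have hc := Measure.countable_meas_pos_of_disjoint_iUnion (μ := μ)
      (As := fun i : s => closedBall (i : X) (ε / 5)) (fun _ => measurableSet_closedBall)
      (fun i j hij => hs i.2 j.2 (Subtype.coe_ne_coe.2 hij))
    have hu : {i : s | 0 < μ (closedBall (i : X) (ε / 5))} = univ :=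
      eq_univ_of_forall fun i =>
        (h i (ε / 5) (by positivity)).trans_le (measure_mono ball_subset_closedBall)
    rw [hu, countable_univ_iff] at hc
    exact hc
  · obtain ⟨y, hy, hsub⟩ := hcov x (mem_univ x)
    refine ⟨y, hy, ?_⟩
    have := hsub (mem_closedBall_self (by positivity))
    simpa [mem_closedBall, mul_div_cancel₀] using this

lemma sigmaFinite_of_measure_ball_lt_top (μ : Measure X) (x₀ : X)
    (h : ∀ ρ : ℝ, 0 < ρ → μ (ball x₀ ρ) < ⊤) : SigmaFinite μ := by
  refine ⟨⟨⟨fun n : ℕ => ball x₀ n, fun _ => trivial, fun n => ?_, iUnion_ball_nat x₀⟩⟩⟩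
  exact (measure_mono (ball_subset_ball (by simp))).trans_lt (h (n + 1) (by positivity))

/-- If the averages of `F` over the balls of radius `Λ` centred in `S` are bounded below, then
the measure of `S` is controlled by the integral of `F`. -/
lemma measure_le_of_one_le_mul_laverage [BorelSpace X] [SecondCountableTopology X]
    {μ : Measure X} [SFinite μ] {Λ : ℝ} {D : ℝ≥0∞} (hfin : ∀ x, μ (ball x Λ) ≠ ⊤)
    (hpos : ∀ x, μ (ball x Λ) ≠ 0) (hD : ∀ x, μ (ball x (2 * Λ)) ≤ D * μ (ball x Λ))
    {S : Set X} (hS : MeasurableSet S) {F : X → ℝ≥0∞} (hF : Measurable F) {c : ℝ≥0∞}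
    (h : ∀ x ∈ S, 1 ≤ c * ⨍⁻ y in ball x Λ, F y ∂μ) :
    μ S ≤ c * D * ∫⁻ x, F x ∂μ := by
  have hset : MeasurableSet {q : X × X | dist q.2 q.1 < Λ} :=
    (isOpen_lt (continuous_snd.dist continuous_fst) continuous_const).measurableSet
  have hball : Measurable fun x => (μ (ball x Λ))⁻¹ :=
    (measurable_measure_prodMk_left (ν := μ) hset).inv
  -- The kernel 1_{d(x,y) < Λ} F(y) / μ(B(x, Λ)): its y-integral is the average of F over B(x, Λ),
  -- and doubling bounds its x-integral by D * F y.
  set k : X → X → ℝ≥0∞ := fun x y =>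
    {q : X × X | dist q.2 q.1 < Λ}.indicator (fun q => (μ (ball q.1 Λ))⁻¹ * F q.2) (x, y) with hk
  have hkm : Measurable (Function.uncurry k) :=
    ((hball.comp measurable_fst).mul (hF.comp measurable_snd)).indicator hset
  have hxk : ∀ x, ∫⁻ y, k x y ∂μ = ⨍⁻ y in ball x Λ, F y ∂μ := by
    intro x
    have : k x = (ball x Λ).indicator fun y => (μ (ball x Λ))⁻¹ * F y := by
      ext y
      by_cases hy : dist y x < Λ <;> simp [hk, hy]
    rw [this, lintegral_indicator measurableSet_ball, lintegral_const_mul _ hF, setLAverage_eq,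
      ENNReal.div_eq_inv_mul]
  have hyk : ∀ y, ∫⁻ x, k x y ∂μ ≤ D * F y := by
    intro y
    have hle : ∀ x, k x y ≤ (ball y Λ).indicator (fun _ => D * (μ (ball y Λ))⁻¹ * F y) x := by
      intro x
      by_cases hxy : dist y x < Λ
      · have hx : x ∈ ball y Λ := by rwa [mem_ball']
        have hsub : ball y Λ ⊆ ball x (2 * Λ) := ball_subset_ball' (by linarith)
        have h1 : μ (ball y Λ) ≤ D * μ (ball x Λ) := (measure_mono hsub).trans (hD x)
        have h2 : (μ (ball x Λ))⁻¹ ≤ D * (μ (ball y Λ))⁻¹ := by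
          rw [← div_eq_mul_inv, ENNReal.le_div_iff_mul_le (Or.inl (hpos y)) (Or.inl (hfin y)),
            mul_comm, ← div_eq_mul_inv]
          exact ENNReal.div_le_of_le_mul h1
        rw [indicator_of_mem hx]
        simpa [hk, hxy] using mul_le_mul_left h2 (F y)
      · simp [hk, hxy]
    refine (lintegral_mono hle).trans_eq ?_
    rw [lintegral_indicator_const measurableSet_ball, mul_right_comm, mul_assoc D,
      ENNReal.inv_mul_cancel (hpos y) (hfin y), mul_one]
  calc μ S = ∫⁻ x in S, 1 ∂μ := by simp
    _ ≤ ∫⁻ x in S, c * ∫⁻ y, k x y ∂μ ∂μ :=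
        setLIntegral_mono' hS fun x hx => by rw [hxk]; exact h x hx
    _ ≤ ∫⁻ x, c * ∫⁻ y, k x y ∂μ ∂μ := setLIntegral_le_lintegral _ _
    _ = c * ∫⁻ x, ∫⁻ y, k x y ∂μ ∂μ := lintegral_const_mul _ hkm.lintegral_prod_right'
    _ = c * ∫⁻ y, ∫⁻ x, k x y ∂μ ∂μ := by rw [lintegral_lintegral_swap hkm.aemeasurable]
    _ ≤ c * ∫⁻ y, D * F y ∂μ := by gcongr with y; exact hyk y
    _ = c * D * ∫⁻ x, F x ∂μ := by rw [lintegral_const_mul _ hF, mul_assoc]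

lemma IsDoublingWith.measure_ball_pow_le {C : ℝ} {μ : Measure X} (h : IsDoublingWith C μ) (x : X)
    {r : ℝ} (hr : 0 < r) (k : ℕ) :
    μ (ball x (2 ^ k * r)) ≤ ENNReal.ofReal C ^ k * μ (ball x r) := by
  induction k with
  | zero => simp
  | succ k ih =>
    rw [pow_succ', mul_assoc, pow_succ', mul_assoc]
    exact (h x _ (by positivity)).trans (by gcongr)

/-- The mean oscillation of a function that is `1` on a part and `0` on another part of `B`. -/
lemma le_setLIntegral_abs_sub {Y : Type*} [MeasurableSpace Y] {μ : Measure Y} {B U V : Set Y}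
    (hUB : U ⊆ B) (hVB : V ⊆ B)
    (hUV : Disjoint U V) (hU : MeasurableSet U) (hV : MeasurableSet V) {v : Y → ℝ}
    (hvU : ∀ x ∈ U, v x = 1) (hvV : ∀ x ∈ V, v x = 0) {m : ℝ≥0∞} (hmU : m ≤ μ U) (hmV : m ≤ μ V)
    (c : ℝ) : m ≤ ∫⁻ y in B, ((v y : EReal) - (c : EReal)).abs ∂μ := by
  have h1 : ∫⁻ y in U, ((v y : EReal) - (c : EReal)).abs ∂μ = ENNReal.ofReal |1 - c| * μ U := by
    rw [← setLIntegral_const]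
    refine setLIntegral_congr_fun hU fun y hy => ?_
    simp only [hvU y hy, ← EReal.coe_sub, EReal.abs_def]
  have h2 : ∫⁻ y in V, ((v y : EReal) - (c : EReal)).abs ∂μ = ENNReal.ofReal |c| * μ V := by
    rw [← setLIntegral_const]
    refine setLIntegral_congr_fun hV fun y hy => ?_
    simp only [hvV y hy, ← EReal.coe_sub, EReal.abs_def, zero_sub, abs_neg]
  -- No constant c is close to both 0 and 1, so the mean value of v never has to be estimated.
  have h3 : (1 : ℝ≥0∞) ≤ ENNReal.ofReal |1 - c| + ENNReal.ofReal |c| := by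
    rw [← ENNReal.ofReal_add (abs_nonneg _) (abs_nonneg _), ENNReal.one_le_ofReal]
    have := abs_add_le (1 - c) c
    rwa [sub_add_cancel, abs_one] at this
  calc m ≤ (ENNReal.ofReal |1 - c| + ENNReal.ofReal |c|) * m := le_mul_of_one_le_left' h3
    _ ≤ ENNReal.ofReal |1 - c| * μ U + ENNReal.ofReal |c| * μ V := by
        rw [add_mul]; gcongr
    _ = ∫⁻ y in U ∪ V, ((v y : EReal) - (c : EReal)).abs ∂μ := by
        rw [lintegral_union hV hUV, h1, h2]
    _ ≤ _ := lintegral_mono_set (union_subset hUB hVB)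

end LowerBound

/-! ### Lower bound for the capacity. -/

section Capacity

variable {X : Type u} [MetricSpace X] [MeasurableSpace X]

/-- An admissible function is the coercion of a real function. -/
lemma IsAdmissible.exists_real {p : ℝ} {μ : Measure X} {E Ω : Set X} {u : X → EReal}
    (hu : IsAdmissible p μ E Ω u) (hE : E ⊆ Ω) :
    ∃ v : X → ℝ, u = (fun x => (v x : EReal)) ∧ (∀ x, |v x| ≤ Ω.indicator 1 x) ∧
      (∀ x ∈ E, v x = 1) ∧ ∀ x ∉ Ω, v x = 0 := by
  obtain ⟨-, h1, h0⟩ := hu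
  have hnn : ∀ x, 0 ≤ u x := by
    intro x
    by_cases hx : x ∈ Ω
    · exact (indicator_nonneg (fun _ _ => zero_le_one) x).trans (h1 x hx).1
    · exact (h0 x hx).ge
  have hle : ∀ x, u x ≤ 1 := by
    intro x
    by_cases hx : x ∈ Ω
    · exact (h1 x hx).2
    · rw [h0 x hx]; exact zero_le_one
  have hcoe : ∀ x, ((u x).toReal : EReal) = u x := fun x =>
    EReal.coe_toReal (ne_top_of_le_ne_top (EReal.coe_ne_top 1) (by simpa using hle x))
      (ne_bot_of_le_ne_bot (EReal.coe_ne_bot 0) (by simpa using hnn x))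
  refine ⟨fun x => (u x).toReal, (funext hcoe).symm, fun x => ?_, fun x hx => ?_, fun x hx => ?_⟩
  · by_cases hx : x ∈ Ω
    · rw [abs_of_nonneg (EReal.toReal_nonneg (hnn x)), indicator_of_mem hx, Pi.one_apply,
        ← EReal.coe_le_coe_iff, hcoe]
      simpa using hle x
    · simp [h0 x hx, hx]
  · have h := (h1 x (hE hx)).1
    rw [indicator_of_mem hx] at h
    have : u x = 1 := le_antisymm (hle x) h
    simp [this]
  · simp [h0 x hx]

/-- The Poincaré inequality on a ball a fixed part of which lies in `{v = 1}` and another in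
`{v = 0}`. -/
lemma SupportsPoincareWith.one_le_mul_laverage {p C lam : ℝ} (hp : 0 < p) {μ : Measure X}
    [BorelSpace X] (hP : SupportsPoincareWith p C lam μ) {x : X} {ρ : ℝ} (hρ : 0 < ρ)
    (hpos : μ (ball x ρ) ≠ 0) (hfin : μ (ball x ρ) ≠ ⊤) {v : X → ℝ}
    (hvm : AEMeasurable (fun x => (v x : EReal)) μ)
    (hv : ∫⁻ y, ((v y : ℝ) : EReal).abs ∂μ < ⊤) {U V : Set X} (hU : MeasurableSet U)
    (hV : MeasurableSet V) (hUB : U ⊆ ball x ρ) (hVB : V ⊆ ball x ρ) (hUV : Disjoint U V)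
    (hvU : ∀ x ∈ U, v x = 1) (hvV : ∀ x ∈ V, v x = 0) {K : ℝ≥0∞} (hK0 : K ≠ 0) (hK : K ≠ ⊤)
    (hKU : μ (ball x ρ) ≤ K * μ U) (hKV : μ (ball x ρ) ≤ K * μ V) {G : X → ℝ≥0∞}
    (hG : IsUpperGradient (fun x => (v x : EReal)) G) :
    1 ≤ (K * ENNReal.ofReal (C * ρ)) ^ p * ⨍⁻ y in ball x (lam * ρ), G y ^ p ∂μ := by
  have h1 := hP x ρ hρ _ hvm hv G hG
  have h2 : K⁻¹ ≤ ⨍⁻ y in ball x ρ,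
      ((v y : EReal) - ((⨍ z in ball x ρ, (v z : EReal).toReal ∂μ : ℝ) : EReal)).abs ∂μ := by
    rw [setLAverage_eq, ENNReal.le_div_iff_mul_le (Or.inl hpos) (Or.inl hfin)]
    have hm : ∀ {W : Set X}, μ (ball x ρ) ≤ K * μ W → K⁻¹ * μ (ball x ρ) ≤ μ W := fun h => by
      rw [← ENNReal.div_eq_inv_mul]
      exact ENNReal.div_le_of_le_mul' h
    exact le_setLIntegral_abs_sub hUB hVB hUV hU hV hvU hvV (hm hKU) (hm hKV) _
  have h3 : 1 ≤ K * (ENNReal.ofReal (C * ρ) *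
      (⨍⁻ y in ball x (lam * ρ), G y ^ p ∂μ) ^ (1 / p)) := by
    rw [← ENNReal.mul_inv_cancel hK0 hK]
    gcongr
    exact h2.trans h1
  have h4 := ENNReal.rpow_le_rpow h3 hp.le
  rwa [ENNReal.one_rpow, ← mul_assoc, ENNReal.mul_rpow_of_nonneg _ _ hp.le, ← ENNReal.rpow_mul,
    one_div, inv_mul_cancel₀ hp.ne', ENNReal.rpow_one] at h4

/-- In the constant, the p-th power comes from the Poincaré inequality on balls of radius 2δ, the
single doubling factor from exchanging integrals, and 2^(p-1) from passing to upper gradients. -/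
theorem measure_annulus_le_variationalCapacity [BorelSpace X] {p CD CP lam a : ℝ} (hp : 1 ≤ p)
    (hCD : 0 < CD) (hCP : 0 < CP) (hlam : 1 ≤ lam) {k : ℕ} (hk : 4 ≤ 2 ^ k * a) {μ : Measure X}
    (hμ : ∀ (x : X) (ρ : ℝ), 0 < ρ → 0 < μ (ball x ρ) ∧ μ (ball x ρ) < ⊤)
    (hD : IsDoublingWith CD μ) (hP : SupportsPoincareWith p CP lam μ) {x₀ : X} {r R : ℝ}
    (hR : 0 < R) (hrR : r < R)
    (hann : ∀ x ∈ ball x₀ R \ ball x₀ r, ∃ x' x'' : X,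
      ball x' (a * (R - r)) ⊆ ball x (2 * (R - r)) ∩ ball x₀ r ∧
      ball x'' (a * (R - r)) ⊆ ball x (2 * (R - r)) \ ball x₀ R) :
    μ (ball x₀ R \ ball x₀ r) ≤
      (ENNReal.ofReal CD ^ k * ENNReal.ofReal (CP * (2 * (R - r)))) ^ p * ENNReal.ofReal CD *
        (2 ^ (p - 1) * variationalCapacity p μ (ball x₀ r) (ball x₀ R)) := by
  have hp0 : 0 < p := zero_lt_one.trans_le hp
  have hδ : 0 < R - r := sub_pos.2 hrR
  have ha : 0 < a := pos_of_mul_pos_right (by linarith : 0 < 2 ^ k * a) (by positivity)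
  have hσ : SigmaFinite μ := sigmaFinite_of_measure_ball_lt_top μ x₀ fun ρ hρ => (hμ x₀ ρ hρ).2
  have hsc := secondCountableTopology_of_measure_ball_pos μ fun x ρ hρ => (hμ x ρ hρ).1
  set K := ENNReal.ofReal CD ^ k
  have hD0 : ENNReal.ofReal CD ≠ 0 := by simpa using hCD
  have hK0 : K ≠ 0 := pow_ne_zero _ hD0
  have hK : K ≠ ⊤ := ENNReal.pow_ne_top ENNReal.ofReal_ne_top
  set c := (K * ENNReal.ofReal (CP * (2 * (R - r)))) ^ p * ENNReal.ofReal CD with hc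
  have hKP0 : K * ENNReal.ofReal (CP * (2 * (R - r))) ≠ 0 :=
    mul_ne_zero hK0 (by simp only [ne_eq, ENNReal.ofReal_eq_zero, not_le]; positivity)
  have hKP : K * ENNReal.ofReal (CP * (2 * (R - r))) ≠ ⊤ :=
    ENNReal.mul_ne_top hK ENNReal.ofReal_ne_top
  have hc0 : c ≠ 0 := mul_ne_zero (by simp [ENNReal.rpow_eq_zero_iff, hKP0, hKP]) hD0
  have hctop : c ≠ ⊤ :=
    ENNReal.mul_ne_top (ENNReal.rpow_ne_top_of_nonneg hp0.le hKP) ENNReal.ofReal_ne_top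
  have h20 : (2 : ℝ≥0∞) ^ (p - 1) ≠ 0 := by simp [ENNReal.rpow_eq_zero_iff]
  have h2top : (2 : ℝ≥0∞) ^ (p - 1) ≠ ⊤ := ENNReal.rpow_ne_top_of_nonneg (by linarith) (by simp)
  -- Here d(x, z) < 2δ, so B(x, 2δ) ⊆ B(z, 4δ) ⊆ B(z, 2^k aδ), and k doublings compare the measures.
  have hKball : ∀ {x z : X}, ball z (a * (R - r)) ⊆ ball x (2 * (R - r)) →
      μ (ball x (2 * (R - r))) ≤ K * μ (ball z (a * (R - r))) := by
    intro x z hz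
    have hzx := mem_ball'.1 (hz (mem_ball_self (by positivity)))
    refine (measure_mono (ball_subset_ball' ?_)).trans
      (hD.measure_ball_pow_le z (by positivity : 0 < a * (R - r)) k)
    nlinarith
  -- With the finite nonzero constant on the left, the bound can be checked on each member of the
  -- infimum. The same device treats the infimum over upper gradients below.
  rw [← mul_assoc, ← ENNReal.div_le_iff' (mul_ne_zero hc0 h20) (ENNReal.mul_ne_top hctop h2top)]
  refine le_iInf₂ fun u hu => le_iInf₂ fun g hg => ?_
  rw [ENNReal.div_le_iff' (mul_ne_zero hc0 h20) (ENNReal.mul_ne_top hctop h2top), mul_assoc]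
  obtain ⟨v, rfl, hv1, hvE, hv0⟩ := hu.exists_real (ball_subset_ball hrR.le)
  refine le_trans ?_ (mul_le_mul_right (iInf_lintegral_upperGradient_le hp isOpen_ball hv0 hg.1) c)
  rw [← ENNReal.div_le_iff' hc0 hctop]
  refine le_iInf₂ fun G hG => ?_
  rw [ENNReal.div_le_iff' hc0 hctop]
  have hvint : ∫⁻ y, ((v y : ℝ) : EReal).abs ∂μ < ⊤ := by
    refine lt_of_le_of_lt (lintegral_mono (g := (ball x₀ R).indicator 1) fun x => ?_) ?_
    · rw [EReal.abs_def]
      refine ENNReal.ofReal_le_of_le_toReal ((hv1 x).trans_eq ?_)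
      by_cases hx : x ∈ ball x₀ R <;> simp [hx]
    · rw [lintegral_indicator_one measurableSet_ball]
      exact (hμ x₀ R hR).2
  have hΛ : 0 < lam * (2 * (R - r)) := by positivity
  refine measure_le_of_one_le_mul_laverage (Λ := lam * (2 * (R - r)))
    (fun x => (hμ x _ hΛ).2.ne) (fun x => (hμ x _ hΛ).1.ne') (fun x => hD x _ hΛ)
    (measurableSet_ball.diff measurableSet_ball) (hG.1.pow_const p) fun x hx => ?_
  obtain ⟨x', x'', h', h''⟩ := hann x hx
  have hB := hμ x (2 * (R - r)) (by positivity)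
  rw [subset_inter_iff] at h'
  rw [subset_sdiff] at h''
  exact hP.one_le_mul_laverage hp0 (by positivity) hB.1.ne' hB.2.ne hu.1.1 hvint
    measurableSet_ball measurableSet_ball h'.1 h''.1
    (disjoint_of_subset_left (h'.2.trans (ball_subset_ball hrR.le)) h''.2.symm)
    (fun y hy => hvE y (h'.2 hy)) (fun y hy => hv0 y (disjoint_left.1 h''.2 hy)) hK0 hK
    (hKball h'.1) (hKball h''.1) hG

end Capacity

end MetricSobolev

theorem mainTheorem6 (p : ℝ) (hp : 1 ≤ p) (CD CP lam a : ℝ)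
    (hCD : 0 < CD) (hCP : 0 < CP) (hlam : 1 ≤ lam) (ha : 0 < a) :
    ∃ A : ℝ, 0 < A ∧
      ∀ (X : Type*) [MetricSpace X] [MeasurableSpace X] [BorelSpace X] (μ : Measure X),
        (∀ (x : X) (ρ : ℝ), 0 < ρ → 0 < μ (ball x ρ) ∧ μ (ball x ρ) < ⊤) →
        MetricSobolev.IsDoublingWith CD μ →
        MetricSobolev.SupportsPoincareWith p CP lam μ →
        ∀ (x₀ : X) (r R : ℝ), 0 < R / 2 → R / 2 ≤ r → r < R →
          (∀ x ∈ ball x₀ R \ ball x₀ r, ∃ x' x'' : X,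
            ball x' (a * (R - r)) ⊆ ball x (2 * (R - r)) ∩ ball x₀ r ∧
            ball x'' (a * (R - r)) ⊆ ball x (2 * (R - r)) \ ball x₀ R) →
          MetricSobolev.variationalCapacity p μ (ball x₀ r) (ball x₀ R)
              ≤ ENNReal.ofReal A * (μ (ball x₀ R \ ball x₀ r) / ENNReal.ofReal ((R - r) ^ p)) ∧
          μ (ball x₀ R \ ball x₀ r) / ENNReal.ofReal ((R - r) ^ p)
              ≤ ENNReal.ofReal A *
                MetricSobolev.variationalCapacity p μ (ball x₀ r) (ball x₀ R) := by
  have hp0 : 0 < p := zero_lt_one.trans_le hp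
  obtain ⟨k, hk⟩ := pow_unbounded_of_one_lt (4 / a) (one_lt_two : (1 : ℝ) < 2)
  have hk' : 4 ≤ 2 ^ k * a := ((div_lt_iff₀ ha).1 hk).le
  set c : ℝ≥0∞ := (ENNReal.ofReal CD ^ k * ENNReal.ofReal (CP * 2)) ^ p * ENNReal.ofReal CD *
    2 ^ (p - 1) with hc
  have hctop : c ≠ ⊤ := by
    refine ENNReal.mul_ne_top (ENNReal.mul_ne_top (ENNReal.rpow_ne_top_of_nonneg hp0.le
      (ENNReal.mul_ne_top (ENNReal.pow_ne_top ENNReal.ofReal_ne_top) ENNReal.ofReal_ne_top))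
      ENNReal.ofReal_ne_top) (ENNReal.rpow_ne_top_of_nonneg (by linarith) (by simp))
  -- The upper bound holds with constant 1 and the lower one with c, which involves only the data
  -- because δ^p factors out of the Poincaré term.
  refine ⟨max 1 c.toReal, by positivity, fun X _ _ _ μ hμ hD hP x₀ r R hR hRr hrR hann => ?_⟩
  have hδ : 0 < R - r := sub_pos.2 hrR
  have hδp : 0 < (R - r) ^ p := Real.rpow_pos_of_pos hδ p
  have hR' : 0 < R := by linarith
  constructor
  · refine (MetricSobolev.variationalCapacity_ball_le hp0 hrR (hμ x₀ R hR').2).trans ?_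
    refine le_mul_of_one_le_left' ?_
    rw [ENNReal.one_le_ofReal]
    exact le_max_left _ _
  · have hcA : c ≤ ENNReal.ofReal (max 1 c.toReal) :=
      (ENNReal.ofReal_toReal hctop).symm.le.trans (ENNReal.ofReal_le_ofReal (le_max_right _ _))
    refine le_trans ?_ (mul_le_mul_left hcA _)
    rw [ENNReal.div_le_iff_le_mul (Or.inl (by simpa using hδp)) (Or.inl ENNReal.ofReal_ne_top)]
    refine (MetricSobolev.measure_annulus_le_variationalCapacity hp hCD hCP hlam hk' hμ hD hP hR'
      hrR hann).trans_eq ?_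
    rw [← mul_assoc CP, ENNReal.ofReal_mul (by positivity : 0 ≤ CP * 2),
      ← mul_assoc (ENNReal.ofReal CD ^ k),
      ENNReal.mul_rpow_of_nonneg (_ * _) _ hp0.le, ENNReal.ofReal_rpow_of_pos hδ, hc]
    ring
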